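/- Let $(S,\mathcal F,\mu)$ be a probability space and let $\mathcal G\subseteq\mathcal F$ be a sub-$\sigma$-algebra. Random variables are identified when they agree $\mu$-almost surely and are ordered by $\mu$-almost sure dominance; $L^0(\mathcal G)$ is the set of real valued $\mathcal G$-measurable random variables and $\bar L^0(\mathcal G)$ is the set of extended real valued ones. All infima and suprema of families of random variables below are taken in the ordered set $\bar L^0(\mathcal G)$ (essential infima and suprema). For a probability measure $\nu$ on $\mathcal F$ and an $\mathcal F$-measurable $x\ge 0$, let $\tilde{\mathbb E}_\nu[x|\mathcal G]$ be the $[0,\infty]$-valued conditional expectation, and put $\mathbb E_\nu[x|\mathcal G]=\tilde{\mathbb E}_\nu[x^+|\mathcal G]-\tilde{\mathbb E}_\nu[x^-|\mathcal G]$ for real valued $x$ whenever this is defined. Let $L^\infty(\mathcal F|\mathcal G)$ be the set of real valued $\mathcal F$-measurable $x$ for which $\inf\{a\in\bar L^0(\mathcal G): a\ge 0,\ |x|\le a\}$ is real valued. Let $\mathcal M(\mathcal G)$ be the set of probability measures $\nu$ on $\mathcal F$ for which there is an $\mathcal F$-measurable $z\ge 0$ with $\mathbb E_\mu[z|\mathcal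 G]=1$ and $\nu(A)=\int_S\mathbb E_\mu[\mathbf 1_A z|\mathcal G]\,d\mu$ for all $A\in\mathcal F$ (such a $\nu$ is absolutely continuous with respect to $\mu$). Let $\Phi$ be the set of continuous, strictly convex functions $\phi:[0,\infty)\to[0,\infty)$ with $\phi(1)=0$ and $\lim_{t\to\infty}\phi(t)/t=\infty$, and for $\phi\in\Phi$ let $\phi^*(m)=\sup_{t\ge 0}\{mt-\phi(t)\}$ for $m\in\mathbb R$. Then for every $\phi\in\Phi$ and every $x\in L^\infty(\mathcal F|\mathcal G)$ both sides of the following equality exist in $\bar L^0(\mathcal G)$, and $$\inf_{\nu\in\mathcal M(\mathcal G)}\Big\{\mathbb E_\nu[x|\mathcal G]+\mathbb E_\mu\Big[\phi\Big(\frac{d\nu}{d\mu}\Big)\Big|\mathcal G\Big]\Big\}=\sup_{a\in L^0(\mathcal G)}\big\{a-\mathbb E_\mu[\phi^*(a-x)|\mathcal G]\big\}.$$ -/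

import Mathlib

open MeasureTheory Set Filter
open scoped ENNReal

noncomputable section

namespace CondOCE

/-! Random variables are represented by measurable functions and compared `μ`-almost surely, so
all notions below are invariant under `μ`-a.e. modification. `F` is the ambient σ-algebra
and `G` is a sub-σ-algebra. -/

/-- `v` is the infimum (essential infimum) of the family `C` in the lattice of extended real
valued `G`-measurable random variables, ordered by `μ`-almost sure dominance. -/
structure IsEssInf {S : Type*} (G : MeasurableSpace S) [F : MeasurableSpace S] (μ : Measure S)
    (C : Set (S → EReal)) (v : S → EReal) : Prop where
  measurable : Measurable[G] v
  le : ∀ f ∈ C, v ≤ᵐ[μ] f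
  greatest : ∀ w : S → EReal, Measurable[G] w → (∀ f ∈ C, w ≤ᵐ[μ] f) → w ≤ᵐ[μ] v

/-- `v` is the supremum (essential supremum) of the family `C` in the lattice of extended real
valued `G`-measurable random variables, ordered by `μ`-almost sure dominance. -/
structure IsEssSup {S : Type*} (G : MeasurableSpace S) [F : MeasurableSpace S] (μ : Measure S)
    (C : Set (S → EReal)) (v : S → EReal) : Prop where
  measurable : Measurable[G] v
  ge : ∀ f ∈ C, f ≤ᵐ[μ] v
  least : ∀ w : S → EReal, Measurable[G] w → (∀ f ∈ C, f ≤ᵐ[μ] w) → v ≤ᵐ[μ] w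

/-- The `[0, ∞]`-valued conditional expectation of a nonnegative random variable,
not assumed to be integrable. -/
def condExpNonneg {S : Type*} (G : MeasurableSpace S) [F : MeasurableSpace S] (μ : Measure S)
    (x : S → ℝ) : S → ℝ≥0∞ :=
  condLExp G μ (fun s => ENNReal.ofReal (x s))

/-- The generalized conditional expectation `Ẽ[x⁺|G] - Ẽ[x⁻|G]`, for random variables that need
not be integrable (`ENNReal.ofReal` truncates at zero, so the two terms are the ones for
the positive and the negative part). -/
def condExpGen {S : Type*} (G : MeasurableSpace S) [F : MeasurableSpace S] (μ : Measure S)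
    (x : S → ℝ) : S → EReal :=
  fun s => (condExpNonneg G μ x s : EReal) - (condExpNonneg G μ (fun r => -x r) s : EReal)

/-- Membership in `L¹(F|G)`: the conditional norm `Ẽ[|x| | G]` is a.s. finite. -/
def MemL1 {S : Type*} (G : MeasurableSpace S) [F : MeasurableSpace S] (μ : Measure S)
    (x : S → ℝ) : Prop :=
  Measurable x ∧ ∀ᵐ s ∂μ, condExpNonneg G μ (fun r => |x r|) s < ∞

/-- The nonnegative extended `G`-measurable random variables dominating `|x|`. -/
def bounds {S : Type*} (G : MeasurableSpace S) [F : MeasurableSpace S] (μ : Measure S)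
    (x : S → ℝ) : Set (S → EReal) :=
  {a | Measurable[G] a ∧ (∀ᵐ s ∂μ, 0 ≤ a s) ∧ ∀ᵐ s ∂μ, ((|x s| : ℝ) : EReal) ≤ a s}

/-- Membership in `L^∞(F|G)`: the conditional norm of `x`, i.e. the essential infimum of the
`G`-measurable bounds of `|x|`, is real valued. -/
def MemLinfty {S : Type*} (G : MeasurableSpace S) [F : MeasurableSpace S] (μ : Measure S)
    (x : S → ℝ) : Prop :=
  Measurable x ∧ ∃ c : S → ℝ, Measurable[G] c ∧
    IsEssInf G μ (bounds G μ x) (fun s => (c s : EReal))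

/-- Conditional densities `Δ(F|G)`: nonnegative elements of `L¹(F|G)` with conditional
expectation one. -/
def IsCondDensity {S : Type*} (G : MeasurableSpace S) [F : MeasurableSpace S] (μ : Measure S)
    (z : S → ℝ) : Prop :=
  MemL1 G μ z ∧ (∀ᵐ s ∂μ, 0 ≤ z s) ∧ ∀ᵐ s ∂μ, condExpGen G μ z s = 1

/-- The set `M(G)` of probability measures on `F` of the form `A ↦ ∫ E_μ[1_A z | G] dμ` for a
conditional density `z`. -/
def measuresM {S : Type*} (G : MeasurableSpace S) [F : MeasurableSpace S] (μ : Measure S) :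
    Set (Measure S) :=
  {ν | IsProbabilityMeasure ν ∧ ∃ z : S → ℝ, IsCondDensity G μ z ∧
    ∀ A : Set S, MeasurableSet A →
      ν A = ∫⁻ s, condExpNonneg G μ (A.indicator z) s ∂μ}

/-- The class `Φ` of continuous strictly convex `φ : [0,∞) → [0,∞)` with `φ 1 = 0` and superlinear
growth. A function on `[0,∞)` is represented by a function on `ℝ` whose values on the
negative half line are irrelevant. -/
structure IsPhi (φ : ℝ → ℝ) : Prop where
  continuousOn : ContinuousOn φ (Ici 0)
  strictConvexOn : StrictConvexOn ℝ (Ici 0) φ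
  nonneg : ∀ t, 0 ≤ t → 0 ≤ φ t
  one : φ 1 = 0
  superlinear : Tendsto (fun t => φ t / t) atTop atTop

/-- The conjugate `φ* m = sup_{t ≥ 0} (m t - φ t)`; the supremum is finite for `φ` in `Φ`, see
`bddAbove_conj`. -/
def conj (φ : ℝ → ℝ) (m : ℝ) : ℝ :=
  sSup ((fun t => m * t - φ t) '' Ici 0)

/-- The conditional `φ`-divergence `E_μ[φ(dν/dμ) | G]`, with values in `[0, ∞]`. -/
def condDiv {S : Type*} (G : MeasurableSpace S) [F : MeasurableSpace S] (μ : Measure S)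
    (φ : ℝ → ℝ) (ν : Measure S) : S → ℝ≥0∞ :=
  condExpNonneg G μ (fun s => φ (ν.rnDeriv μ s).toReal)

/-- The supremum defining the conjugate of an element of `Φ` is finite. -/
theorem bddAbove_conj {φ : ℝ → ℝ} (hφ : IsPhi φ) (m : ℝ) :
    BddAbove ((fun t => m * t - φ t) '' Ici 0) := by
  obtain ⟨T, hT⟩ := (hφ.superlinear.eventually_ge_atTop m).exists_forall_of_atTop
  refine ⟨|m| * (|T| + 1), ?_⟩
  rintro _ ⟨t, ht, rfl⟩
  have ht0 : (0 : ℝ) ≤ t := ht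
  have hφt := hφ.nonneg t ht0
  have hR : 0 ≤ |m| * (|T| + 1) := by positivity
  dsimp only
  rcases le_or_gt t (|T| + 1) with h | h
  · have h1 : m * t ≤ |m| * t := mul_le_mul_of_nonneg_right (le_abs_self m) ht0
    have h2 : |m| * t ≤ |m| * (|T| + 1) := mul_le_mul_of_nonneg_left h (abs_nonneg m)
    linarith
  · have htpos : 0 < t := by have := abs_nonneg T; linarith
    have h1 := hT t (by have := le_abs_self T; linarith)
    rw [le_div_iff₀ htpos] at h1
    linarith

/-- The set of `G`-measurable bounds of `|x|` has a minimum. -/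
theorem exists_min_bounds {S : Type*} (G : MeasurableSpace S) [F : MeasurableSpace S]
    (hG : G ≤ F) (μ : Measure S) [IsProbabilityMeasure μ] (x : S → ℝ) :
    ∃ a ∈ bounds G μ x, ∀ b ∈ bounds G μ x, a ≤ᵐ[μ] b := by
  let I : (S → EReal) → ℝ≥0∞ := fun a => ∫⁻ s, (1 + (a s).toENNReal)⁻¹ ∂μ
  have hI1 : ∀ a, I a ≤ 1 := fun a => by
    calc I a ≤ ∫⁻ _, 1 ∂μ := lintegral_mono fun s => by
          rw [ENNReal.inv_le_one]; exact le_self_add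
      _ = 1 := by simp
  have hmeas : ∀ a ∈ bounds G μ x, Measurable fun s => (1 + (a s).toENNReal)⁻¹ := fun a ha =>
    ((measurable_ereal_toENNReal.comp (ha.1.mono hG le_rfl)).const_add 1).inv
  have hmono : ∀ a b : S → EReal, (∀ s, a s ≤ b s) → I b ≤ I a := fun a b h =>
    lintegral_mono fun s => by
      dsimp only
      gcongr
      exact EReal.toENNReal_le_toENNReal (h s)
  have hne : (I '' bounds G μ x).Nonempty :=
    ⟨_, fun _ => ⊤, ⟨measurable_const, by simp, by simp⟩, rfl⟩
  obtain ⟨u, -, hu, hmem⟩ := exists_seq_tendsto_sSup hne (OrderTop.bddAbove _)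
  choose a ha hau using hmem
  have hinf : (fun s => ⨅ n, a n s) ∈ bounds G μ x := by
    refine ⟨Measurable.iInf fun n => (ha n).1, ?_, ?_⟩
    · filter_upwards [ae_all_iff.2 fun n => (ha n).2.1] with s hs using le_iInf hs
    · filter_upwards [ae_all_iff.2 fun n => (ha n).2.2] with s hs using le_iInf hs
  have hsup : sSup (I '' bounds G μ x) ≤ I (fun s => ⨅ n, a n s) :=
    le_of_tendsto' hu fun n => by
      rw [← hau n]; exact hmono _ _ fun s => iInf_le _ n
  refine ⟨_, hinf, fun b hb => ?_⟩
  set c : S → EReal := fun s => ⨅ n, a n s with hc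
  have hcb : (fun s => min (c s) (b s)) ∈ bounds G μ x := by
    refine ⟨Measurable.min hinf.1 hb.1, ?_, ?_⟩
    · filter_upwards [hinf.2.1, hb.2.1] with s h1 h2 using le_min h1 h2
    · filter_upwards [hinf.2.2, hb.2.2] with s h1 h2 using le_min h1 h2
  have hle : I (fun s => min (c s) (b s)) ≤ I c :=
    (le_sSup (mem_image_of_mem I hcb)).trans hsup
  have hae := ae_eq_of_ae_le_of_lintegral_le (μ := μ)
    (f := fun s => (1 + (c s).toENNReal)⁻¹)
    (g := fun s => (1 + (min (c s) (b s)).toENNReal)⁻¹)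
    (Eventually.of_forall fun s => by
      dsimp only
      gcongr
      exact EReal.toENNReal_le_toENNReal (min_le_left _ _))
    ((hI1 c).trans_lt ENNReal.one_lt_top).ne (hmeas _ hcb).aemeasurable hle
  filter_upwards [hae, hinf.2.1, hb.2.1] with s h h1 h2
  have h3 : (c s).toENNReal = (min (c s) (b s)).toENNReal :=
    (ENNReal.add_right_inj ENNReal.one_ne_top).1 (inv_injective h)
  have h4 : c s = min (c s) (b s) := by
    have h5 := congrArg (fun t : ℝ≥0∞ => (t : EReal)) h3
    simpa only [EReal.coe_toENNReal h1, EReal.coe_toENNReal (le_min h1 h2)] using h5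
  exact h4.le.trans (min_le_right _ _)

/-- `x` belongs to `L^∞(F|G)` exactly when `|x|` has a real valued `G`-measurable bound. -/
theorem memLinfty_iff {S : Type*} (G : MeasurableSpace S) [F : MeasurableSpace S]
    (hG : G ≤ F) (μ : Measure S) [IsProbabilityMeasure μ] (x : S → ℝ) :
    MemLinfty G μ x ↔
      Measurable x ∧ ∃ c : S → ℝ, Measurable[G] c ∧ ∀ᵐ s ∂μ, |x s| ≤ c s := by
  obtain ⟨a, ha, hmin⟩ := exists_min_bounds G hG μ x
  refine and_congr_right fun hx => ⟨?_, ?_⟩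
  · rintro ⟨c, hc, h⟩
    refine ⟨c, hc, ?_⟩
    filter_upwards [h.greatest a ha.1 hmin, ha.2.2] with s h1 h2
    exact_mod_cast h2.trans h1
  · rintro ⟨c, hc, h⟩
    have hcb : (fun s => (c s : EReal)) ∈ bounds G μ x := by
      refine ⟨measurable_coe_real_ereal.comp hc, ?_, ?_⟩
      · filter_upwards [h] with s hs
        exact_mod_cast (abs_nonneg _).trans hs
      · filter_upwards [h] with s hs
        exact_mod_cast hs
    have hfin : (fun s => ((a s).toReal : EReal)) =ᵐ[μ] a := by
      filter_upwards [hmin _ hcb, ha.2.1] with s h1 h2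
      exact EReal.coe_toReal (h1.trans_lt (EReal.coe_lt_top _)).ne
        (EReal.bot_lt_zero.trans_le h2).ne'
    have hm : Measurable[G] fun s => (a s).toReal :=
      measurable_ereal_toReal.comp ha.1
    refine ⟨_, hm, measurable_coe_real_ereal.comp hm, ?_, ?_⟩
    · intro f hf
      exact hfin.le.trans (hmin f hf)
    · intro w _ hw
      exact (hw a ha).trans hfin.symm.le

end CondOCE

end

/-! Weak duality: let `z ≥ 0` have conditional expectation one. Taking conditional expectations in
the Fenchel-Young inequality `(a - x) z - φ z ≤ φ* (a - x)` and pulling out the `G`-measurable `a`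
bounds every dual value by every primal value. Equality holds when `z` maximizes `t ↦ (a - x) t - φ
t` on `[0, ∞)`.

Superlinear growth gives a maximizer `g m` at each slope `m`, and strict convexity makes it unique;
hence `g` is continuous and monotone, with `g 0 = 1`. If `|x| ≤ c` with `c` `G`-measurable, then `g
(-c - x) ≤ 1 ≤ g (c - x)`. A conditional intermediate value theorem, run on the conditional law of
`x` given `G`, yields a `G`-measurable `α` such that `g (α - x)` has conditional expectation one. So
`α` and the measure with density `g (α - x)` attain the supremum and the infimum at a common value.

The key results are `exists_continuous_argmax`, `exists_condLExp_shift_eq_one` and `dual_le_primal`.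
-/

namespace CondOCE

/-! ### The conjugate and its maximizer -/

/-- The Fenchel-Young inequality. -/
theorem mul_sub_le_conj {φ : ℝ → ℝ} (hφ : IsPhi φ) (m : ℝ) {t : ℝ} (ht : 0 ≤ t) :
    m * t - φ t ≤ conj φ m :=
  le_csSup (bddAbove_conj hφ m) ⟨t, ht, rfl⟩

theorem conj_mono {φ : ℝ → ℝ} (hφ : IsPhi φ) : Monotone (conj φ) := by
  intro m n hmn
  refine csSup_le ⟨_, 0, self_mem_Ici, rfl⟩ ?_
  rintro _ ⟨t, ht, rfl⟩
  have ht' : (0 : ℝ) ≤ t := ht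
  have := mul_sub_le_conj hφ n ht'
  have := mul_le_mul_of_nonneg_right hmn ht'
  dsimp only
  linarith

theorem neg_apply_zero_le_conj {φ : ℝ → ℝ} (hφ : IsPhi φ) (m : ℝ) : -φ 0 ≤ conj φ m := by
  simpa using mul_sub_le_conj hφ m le_rfl

/-- The supremum defining the conjugate is attained. -/
theorem exists_forall_mul_sub_le {φ : ℝ → ℝ} (hφ : IsPhi φ) (m : ℝ) :
    ∃ t, 0 ≤ t ∧ ∀ u, 0 ≤ u → m * u - φ u ≤ m * t - φ t := by
  obtain ⟨T, hT⟩ := (hφ.superlinear.eventually_ge_atTop (m + 1)).exists_forall_of_atTop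
  have h0 := hφ.nonneg 0 le_rfl
  -- For `u > R`, `φ u ≥ (m + 1) u` gives `m u - φ u ≤ -u < -φ 0`, the negative of `φ 0` being the
  -- value at zero. So a maximum over `[0, R]` is global.
  set R : ℝ := |T| + φ 0 with hR
  have hR0 : 0 ≤ R := by positivity
  have hc : ContinuousOn (fun t => m * t - φ t) (Icc 0 R) :=
    (by fun_prop : Continuous fun t : ℝ => m * t).continuousOn.sub
      (hφ.continuousOn.mono Icc_subset_Ici_self)
  obtain ⟨t, ht, hmax⟩ := isCompact_Icc.exists_isMaxOn (nonempty_Icc.2 hR0) hc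
  refine ⟨t, ht.1, fun u hu => ?_⟩
  rcases le_or_gt u R with h | h
  · exact hmax ⟨hu, h⟩
  · have h1 := hT u (by have := le_abs_self T; linarith)
    rw [le_div_iff₀ (hR0.trans_lt h)] at h1
    have h2 : m * 0 - φ 0 ≤ m * t - φ t := hmax (left_mem_Icc.2 hR0)
    have := abs_nonneg T
    linarith

/-- By strict convexity the midpoint of two distinct maximizers would do strictly better. -/
theorem eq_of_forall_mul_sub_le {φ : ℝ → ℝ} (hφ : IsPhi φ) {m t u : ℝ} (ht : 0 ≤ t) (hu : 0 ≤ u)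
    (ht' : ∀ r, 0 ≤ r → m * r - φ r ≤ m * t - φ t)
    (hu' : ∀ r, 0 ≤ r → m * r - φ r ≤ m * u - φ u) : t = u := by
  by_contra hne
  have h := hφ.strictConvexOn.2 ht hu hne (one_half_pos (α := ℝ)) one_half_pos (add_halves 1)
  simp only [smul_eq_mul] at h
  have h1 := ht' (1 / 2 * t + 1 / 2 * u) (by positivity)
  have h2 := hu' t ht
  linarith

/-- The maximizer in the definition of the conjugate depends continuously and monotonically
on the slope. -/
theorem exists_continuous_argmax {φ : ℝ → ℝ} (hφ : IsPhi φ) :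
    ∃ g : ℝ → ℝ, Continuous g ∧ Monotone g ∧ (∀ m, 0 ≤ g m) ∧ g 0 = 1 ∧
      ∀ m, conj φ m = m * g m - φ (g m) := by
  choose g hg0 hg using exists_forall_mul_sub_le hφ
  have hmono : Monotone g := by
    intro m n hmn
    rcases hmn.eq_or_lt with rfl | hlt
    · exact le_rfl
    have h1 := hg m (g n) (hg0 n)
    have h2 := hg n (g m) (hg0 m)
    by_contra! h
    nlinarith [mul_pos (sub_pos.2 hlt) (sub_pos.2 h)]
  -- Maximality passes to limits, so uniqueness identifies any limit of `g` at `m`. The one-sided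
  -- limits exist by monotonicity, hence both equal `g m`.
  have hlim : ∀ (m l : ℝ) (L : Filter ℝ) [L.NeBot], L ≤ nhds m → Tendsto g L (nhds l) →
      l = g m := by
    intro m l L _ hL hl
    have hl0 : 0 ≤ l := ge_of_tendsto' hl hg0
    refine eq_of_forall_mul_sub_le hφ hl0 (hg0 m) (fun t ht => ?_) (hg m)
    have hid : Tendsto (fun n : ℝ => n) L (nhds m) := hL
    have hφl : Tendsto (fun n => φ (g n)) L (nhds (φ l)) :=
      (hφ.continuousOn l hl0).tendsto.comp
        (tendsto_nhdsWithin_iff.2 ⟨hl, Eventually.of_forall hg0⟩)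
    exact le_of_tendsto_of_tendsto' ((hid.mul_const t).sub_const (φ t)) ((hid.mul hl).sub hφl)
      fun n => hg n t ht
  refine ⟨g, continuous_iff_continuousAt.2 fun m => ?_, hmono, hg0, ?_, fun m => ?_⟩
  · rw [hmono.continuousAt_iff_leftLim_eq_rightLim,
      hlim m _ _ nhdsWithin_le_nhds (hmono.tendsto_leftLim m),
      hlim m _ _ nhdsWithin_le_nhds (hmono.tendsto_rightLim m)]
  · refine eq_of_forall_mul_sub_le hφ (hg0 0) zero_le_one (hg 0) fun r hr => ?_
    simpa [hφ.one] using hφ.nonneg r hr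
  · refine le_antisymm (csSup_le ⟨_, 0, self_mem_Ici, rfl⟩ ?_) (mul_sub_le_conj hφ m (hg0 m))
    rintro _ ⟨t, ht, rfl⟩
    exact hg m t ht

/-! ### Measurable intermediate value theorem and the normalizing shift -/

/-- Truncation of `y` to the interval `[-c, c]`. -/
def clamp (c y : ℝ) : ℝ := max (-c) (min c y)

theorem neg_le_clamp (c y : ℝ) : -c ≤ clamp c y := le_max_left _ _

theorem clamp_le {c : ℝ} (hc : 0 ≤ c) (y : ℝ) : clamp c y ≤ c :=
  max_le (by linarith) (min_le_left _ _)

theorem clamp_of_abs_le {c y : ℝ} (h : |y| ≤ c) : clamp c y = y := by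
  rw [abs_le] at h
  rw [clamp, min_eq_right h.2, max_eq_right h.1]

theorem continuous_clamp (c : ℝ) : Continuous (clamp c) := by
  unfold clamp; fun_prop

@[fun_prop]
theorem measurable_clamp {α : Type*} [MeasurableSpace α] {c y : α → ℝ} (hc : Measurable c)
    (hy : Measurable y) : Measurable fun s => clamp (c s) (y s) :=
  hc.neg.max (hc.min hy)

/-- Measurable intermediate value theorem: a family of monotone continuous functions that cross
the level `1` between `-c b` and `c b` does so at a point depending measurably on `b`. -/
theorem exists_measurable_root {β : Type*} [MeasurableSpace β] {H : β → ℝ → ℝ≥0∞} {c : β → ℝ}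
    (hc : Measurable c) (hc0 : ∀ b, 0 ≤ c b) (hH : ∀ q, Measurable fun b => H b q)
    (hcont : ∀ b, Continuous (H b)) (hlow : ∀ b, H b (-c b) ≤ 1)
    (hupp : ∀ b, 1 ≤ H b (c b)) :
    ∃ α : β → ℝ, Measurable α ∧ (∀ b, |α b| ≤ c b) ∧ ∀ b, H b (α b) = 1 := by
  classical
  -- The root is the supremum of the rationals in `[-c b, c b]` at level at most one; a countable
  -- supremum keeps it measurable. The default `-c b` is itself at level at most one.
  let u : ℚ → β → ℝ := fun q b => if H b q ≤ 1 ∧ |(q : ℝ)| ≤ c b then q else -c b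
  have hu_le : ∀ q b, u q b ≤ c b := fun q b => by
    dsimp only [u]
    split_ifs with h
    · exact (abs_le.1 h.2).2
    · linarith [hc0 b]
  have hu_ge : ∀ q b, -c b ≤ u q b := fun q b => by
    dsimp only [u]
    split_ifs with h
    · exact (abs_le.1 h.2).1
    · exact le_rfl
  have hbdd : ∀ b, BddAbove (range fun q => u q b) := fun b =>
    ⟨c b, by rintro _ ⟨q, rfl⟩; exact hu_le q b⟩
  have hH_u : ∀ q b, H b (u q b) ≤ 1 := fun q b => by
    dsimp only [u]
    split_ifs with h
    · exact h.1
    · exact hlow b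
  have hle : ∀ b, ⨆ q, u q b ≤ c b := fun b => ciSup_le fun q => hu_le q b
  refine ⟨fun b => ⨆ q, u q b, ?_, fun b => abs_le.2 ⟨?_, hle b⟩, fun b => ?_⟩
  · refine Measurable.iSup fun q => Measurable.ite ?_ measurable_const hc.neg
    exact (measurableSet_le (hH q) measurable_const).inter
      (measurableSet_le measurable_const hc)
  · exact (hu_ge 0 b).trans (le_ciSup (hbdd b) 0)
  · have hcl : IsClosed {r | H b r ≤ 1} := isClosed_le (hcont b) continuous_const
    have h1 : H b (⨆ q, u q b) ≤ 1 :=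
      hcl.closure_subset_iff.2 (by rintro _ ⟨q, rfl⟩; exact hH_u q b)
        (csSup_mem_closure (range_nonempty _) (hbdd b))
    -- Below level one, continuity would leave room for an admissible rational to the right of the
    -- supremum.
    refine le_antisymm h1 (not_lt.1 fun hlt => ?_)
    have hltc : ⨆ q, u q b < c b := lt_of_le_of_ne (hle b) fun h =>
      (hupp b).not_gt (h ▸ hlt)
    have hev : ∀ᶠ r in nhds (⨆ q, u q b), H b r < 1 :=
      (hcont b).continuousAt.eventually_lt continuousAt_const hlt
    obtain ⟨d, hd, hdd⟩ := exists_Ico_subset_of_mem_nhds hev ⟨_, hltc⟩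
    obtain ⟨q, hq1, hq2⟩ := exists_rat_btwn (lt_min hd hltc)
    have hqc : |(q : ℝ)| ≤ c b := abs_le.2
      ⟨((hu_ge 0 b).trans (le_ciSup (hbdd b) 0)).trans hq1.le, hq2.le.trans (min_le_right _ _)⟩
    have hHq : H b q < 1 := hdd ⟨hq1.le, hq2.trans_le (min_le_left _ _)⟩
    have : u q b = q := if_pos ⟨hHq.le, hqc⟩
    exact (le_ciSup (hbdd b) q).not_gt (by simpa only [this] using hq1)

/-- A shift `α` under which the kernel averages of `g (α b - y)`, with `y` truncated
to `[-c b, c b]`, are all equal to one. -/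
theorem exists_measurable_shift {β : Type*} [MeasurableSpace β]
    (κ : ProbabilityTheory.Kernel β ℝ) [ProbabilityTheory.IsMarkovKernel κ] {g : ℝ → ℝ}
    (hgc : Continuous g) (hg : Monotone g) (hg1 : g 0 = 1) {c : β → ℝ} (hc : Measurable c)
    (hc0 : ∀ b, 0 ≤ c b) :
    ∃ α : β → ℝ, Measurable α ∧ (∀ b, |α b| ≤ c b) ∧
      ∀ b, ∫⁻ y, ENNReal.ofReal (g (α b - clamp (c b) y)) ∂κ b = 1 := by
  -- Clamping the shift too lets the constant `g (c b + c b)` dominate the integrands for all shifts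
  -- at once. The root lies in `[-c b, c b]`, where this clamp has no effect.
  suffices h : ∃ α : β → ℝ, Measurable α ∧ (∀ b, |α b| ≤ c b) ∧
      ∀ b, ∫⁻ y, ENNReal.ofReal (g (clamp (c b) (α b) - clamp (c b) y)) ∂κ b = 1 by
    obtain ⟨α, hα, hαc, h⟩ := h
    refine ⟨α, hα, hαc, fun b => ?_⟩
    simpa only [clamp_of_abs_le (hαc b)] using h b
  refine exists_measurable_root
    (H := fun b a => ∫⁻ y, ENNReal.ofReal (g (clamp (c b) a - clamp (c b) y)) ∂κ b) hc hc0
    (fun q => ?_) (fun b => ?_) (fun b => ?_) (fun b => ?_)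
  · refine Measurable.lintegral_kernel_prod_right
      (f := fun b y => ENNReal.ofReal (g (clamp (c b) q - clamp (c b) y))) ?_
    refine (hgc.measurable.comp ((measurable_clamp (hc.comp measurable_fst) measurable_const).sub
      (measurable_clamp (hc.comp measurable_fst) measurable_snd))).ennreal_ofReal
  · refine continuous_iff_continuousAt.2 fun a => ?_
    refine tendsto_lintegral_filter_of_dominated_convergence
      (fun _ => ENNReal.ofReal (g (c b + c b))) (Eventually.of_forall fun a => ?_)
      (Eventually.of_forall fun a => Eventually.of_forall fun y => ?_) (by simp)
      (Eventually.of_forall fun y => ?_)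
    · exact (hgc.measurable.comp (measurable_const.sub
        (measurable_clamp measurable_const measurable_id))).ennreal_ofReal
    · refine ENNReal.ofReal_le_ofReal (hg ?_)
      linarith [clamp_le (hc0 b) a, neg_le_clamp (c b) y]
    · exact (ENNReal.continuous_ofReal.comp (hgc.comp
        ((continuous_clamp (c b)).sub continuous_const))).tendsto a
  · calc _ ≤ ∫⁻ _, 1 ∂κ b := lintegral_mono fun y => by
          rw [clamp_of_abs_le (by rw [abs_neg, abs_of_nonneg (hc0 b)]), ENNReal.ofReal_le_one,
            ← hg1]
          exact hg (by linarith [neg_le_clamp (c b) y])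
      _ = 1 := by simp
  · calc (1 : ℝ≥0∞) = ∫⁻ _, 1 ∂κ b := by simp
      _ ≤ _ := lintegral_mono fun y => by
          rw [clamp_of_abs_le (by rw [abs_of_nonneg (hc0 b)]), ENNReal.one_le_ofReal, ← hg1]
          exact hg (by linarith [clamp_le (hc0 b) y])

/-- Disintegration formula for the conditional expectation given a random variable `p`. -/
theorem condLExp_comap_ae_eq {S β : Type*} [MeasurableSpace S] [mβ : MeasurableSpace β]
    (μ : Measure S) [IsProbabilityMeasure μ] {p : S → β} (hp : Measurable p) {x : S → ℝ}
    (hx : Measurable x) {f : β × ℝ → ℝ≥0∞} (hf : Measurable f) :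
    condLExp (mβ.comap p) μ (fun s => f (p s, x s)) =ᵐ[μ]
      fun s => ∫⁻ y, f (p s, y) ∂ProbabilityTheory.condDistrib x p μ (p s) := by
  have hm : Measurable fun b => ∫⁻ y, f (b, y) ∂ProbabilityTheory.condDistrib x p μ b :=
    Measurable.lintegral_kernel_prod_right' hf
  refine (ae_eq_condLExp hp.comap_le μ _ (hm.comp (comap_measurable p)) ?_).symm
  rintro _ ⟨B, hB, rfl⟩
  simp only [Function.comp_apply]
  rw [← setLIntegral_map hB hm hp]
  have h := Measure.setLIntegral_compProd (μ := μ.map p)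
    (κ := ProbabilityTheory.condDistrib x p μ) hf hB MeasurableSet.univ
  simp only [Measure.restrict_univ] at h
  rw [← h, ProbabilityTheory.compProd_map_condDistrib hx.aemeasurable,
    setLIntegral_map (hB.prod MeasurableSet.univ) hf (hp.prodMk hx)]
  congr 2
  ext s
  simp

/-- A conditional version of `exists_measurable_shift`. -/
theorem exists_condLExp_shift_eq_one {S β : Type*} [MeasurableSpace S] [mβ : MeasurableSpace β]
    (μ : Measure S) [IsProbabilityMeasure μ] {p : S → β} (hp : Measurable p) {x : S → ℝ}
    (hx : Measurable x) {g : ℝ → ℝ} (hgc : Continuous g) (hg : Monotone g) (hg1 : g 0 = 1)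
    {c : β → ℝ} (hc : Measurable c) (hc0 : ∀ b, 0 ≤ c b) (hxc : ∀ᵐ s ∂μ, |x s| ≤ c (p s)) :
    ∃ α : β → ℝ, Measurable α ∧ (∀ b, |α b| ≤ c b) ∧
      condLExp (mβ.comap p) μ (fun s => ENNReal.ofReal (g (α (p s) - x s))) =ᵐ[μ] 1 := by
  obtain ⟨α, hα, hαc, h⟩ :=
    exists_measurable_shift (ProbabilityTheory.condDistrib x p μ) hgc hg hg1 hc hc0
  have hf : Measurable fun q : β × ℝ => ENNReal.ofReal (g (α q.1 - clamp (c q.1) q.2)) :=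
    (hgc.measurable.comp ((hα.comp measurable_fst).sub
      (measurable_clamp (hc.comp measurable_fst) measurable_snd))).ennreal_ofReal
  refine ⟨α, hα, hαc, ?_⟩
  have h1 : (fun s => ENNReal.ofReal (g (α (p s) - x s))) =ᵐ[μ]
      fun s => ENNReal.ofReal (g (α (p s) - clamp (c (p s)) (x s))) := by
    filter_upwards [hxc] with s hs
    rw [clamp_of_abs_le hs]
  filter_upwards [condLExp_congr_ae (mΩ := mβ.comap p) h1, condLExp_comap_ae_eq μ hp hx hf]
    with s hs1 hs2
  rw [hs1, hs2]
  exact h _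

/-! ### Pull-out property and change of measure -/

/-- The pull-out property of the Lebesgue conditional expectation. -/
theorem condLExp_mul_of_measurable_left {S : Type*} {G : MeasurableSpace S} [F : MeasurableSpace S]
    (hG : G ≤ F) (μ : Measure S) [IsFiniteMeasure μ] {a X : S → ℝ≥0∞}
    (ha : Measurable[G] a) (hX : Measurable X) :
    condLExp G μ (fun s => a s * X s) =ᵐ[μ] fun s => a s * condLExp G μ X s := by
  have ha' : Measurable a := ha.mono hG le_rfl
  -- The densities `X` and `condLExp G μ X` define the same measure on `G`, so they give the same
  -- integrals of `G`-measurable functions.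
  have htrim : (μ.withDensity (condLExp G μ X)).trim hG = (μ.withDensity X).trim hG := by
    refine @Measure.ext _ G _ _ fun A hA => ?_
    rw [trim_measurableSet_eq hG hA, trim_measurableSet_eq hG hA, withDensity_apply _ (hG _ hA),
      withDensity_apply _ (hG _ hA), setLIntegral_condLExp hG μ X hA]
  refine (ae_eq_condLExp hG μ _ (ha.mul (measurable_condLExp G μ X)) fun A hA => ?_).symm
  have key : ∀ Y : S → ℝ≥0∞, Measurable Y →
      ∫⁻ s in A, a s * Y s ∂μ = ∫⁻ s in A, a s ∂((μ.withDensity Y).trim hG) := fun Y hY => by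
    rw [setLIntegral_trim hG ha hA, setLIntegral_withDensity_eq_setLIntegral_mul μ hY ha' (hG _ hA)]
    simp only [Pi.mul_apply, mul_comm]
  simp only [Pi.mul_apply]
  rw [key _ (measurable_condLExp' G μ X), key _ hX, htrim]

/-- A measure whose density has conditional expectation one agrees with the reference measure
on the smaller σ-algebra. -/
theorem trim_withDensity_eq {S : Type*} {G : MeasurableSpace S} [F : MeasurableSpace S]
    (hG : G ≤ F) (μ : Measure S) [IsFiniteMeasure μ] {Z : S → ℝ≥0∞}
    (hZ : condLExp G μ Z =ᵐ[μ] 1) : (μ.withDensity Z).trim hG = μ.trim hG := by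
  refine @Measure.ext _ G _ _ fun A hA => ?_
  rw [trim_measurableSet_eq hG hA, trim_measurableSet_eq hG hA, withDensity_apply _ (hG _ hA),
    ← setLIntegral_condLExp hG μ Z hA, lintegral_congr_ae (ae_restrict_of_ae hZ)]
  simp

/-- Bayes' rule for a density with conditional expectation one. -/
theorem condLExp_withDensity_ae_eq {S : Type*} {G : MeasurableSpace S} [F : MeasurableSpace S]
    (hG : G ≤ F) (μ : Measure S) [IsFiniteMeasure μ] {X Z : S → ℝ≥0∞} (hX : Measurable X)
    (hZm : Measurable Z) (hZ : condLExp G μ Z =ᵐ[μ] 1) :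
    condLExp G (μ.withDensity Z) X =ᵐ[μ] condLExp G μ (fun s => X s * Z s) := by
  have htrim := trim_withDensity_eq hG μ hZ
  -- Conditioning under the new measure needs this; its restriction to `G` is that of `μ`, hence
  -- finite.
  have : SigmaFinite ((μ.withDensity Z).trim hG) := by rw [htrim]; infer_instance
  refine ae_eq_condLExp hG μ _ (measurable_condLExp G _ X) fun A hA => ?_
  rw [← setLIntegral_trim hG (measurable_condLExp G _ X) hA, ← htrim,
    setLIntegral_trim hG (measurable_condLExp G _ X) hA, setLIntegral_condLExp hG _ X hA,
    setLIntegral_withDensity_eq_setLIntegral_mul μ hZm hX (hG _ hA)]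
  simp only [Pi.mul_apply, mul_comm]

/-! ### Arithmetic of positive and negative parts -/

/-- The hypothesis is free of subtraction, so it can come from monotonicity of `[0, ∞]`-valued
conditional expectations. Only `D`, the divergence, may be infinite, and then the right side is `⊤`.
-/
theorem coe_sub_sub_le {a : ℝ} {A B C C' D : ℝ≥0∞} (hA : A ≠ ∞) (hB : B ≠ ∞) (hC : C ≠ ∞)
    (hC' : C' ≠ ∞) (h : ENNReal.ofReal a + B + C' ≤ D + C + A + ENNReal.ofReal (-a)) :
    (a : EReal) - ((C : EReal) - (C' : EReal)) ≤ (A : EReal) - (B : EReal) + (D : EReal) := by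
  lift A to NNReal using hA
  lift B to NNReal using hB
  lift C to NNReal using hC
  lift C' to NNReal using hC'
  have ha := max_zero_sub_max_neg_zero_eq_self a
  rcases eq_or_ne D ∞ with rfl | hD
  · have h1 : ((A : ℝ≥0∞) : EReal) - ((B : ℝ≥0∞) : EReal) = ((A - B : ℝ) : EReal) := rfl
    rw [h1, EReal.coe_ennreal_top, EReal.coe_add_top]
    exact le_top
  · lift D to NNReal using hD
    have h2 := (ENNReal.toReal_le_toReal (by finiteness) (by finiteness)).2 h
    rw [ENNReal.toReal_add (by finiteness) (by finiteness),
      ENNReal.toReal_add (by finiteness) (by finiteness),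
      ENNReal.toReal_add (by finiteness) (by finiteness),
      ENNReal.toReal_add (by finiteness) (by finiteness),
      ENNReal.toReal_add (by finiteness) (by finiteness),
      ENNReal.toReal_ofReal', ENNReal.toReal_ofReal'] at h2
    simp only [ENNReal.coe_toReal] at h2
    change ((a - (C - C') : ℝ) : EReal) ≤ ((A - B + D : ℝ) : EReal)
    rw [EReal.coe_le_coe_iff]
    linarith

theorem coe_sub_sub_eq {a : ℝ} {A B C C' D : ℝ≥0∞} (hA : A ≠ ∞) (hB : B ≠ ∞) (hC : C ≠ ∞)
    (hC' : C' ≠ ∞) (h : ENNReal.ofReal a + B + C' = D + C + A + ENNReal.ofReal (-a)) :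
    (a : EReal) - ((C : EReal) - (C' : EReal)) = (A : EReal) - (B : EReal) + (D : EReal) := by
  -- With equality, the finite left side forces the divergence to be finite.
  have hD : D ≠ ∞ := by
    rintro rfl
    have : ENNReal.ofReal a + B + C' ≠ ∞ := by finiteness
    simp [h] at this
  lift A to NNReal using hA
  lift B to NNReal using hB
  lift C to NNReal using hC
  lift C' to NNReal using hC'
  lift D to NNReal using hD
  have ha := max_zero_sub_max_neg_zero_eq_self a
  have h2 := congrArg ENNReal.toReal h
  rw [ENNReal.toReal_add (by finiteness) (by finiteness),
    ENNReal.toReal_add (by finiteness) (by finiteness),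
    ENNReal.toReal_add (by finiteness) (by finiteness),
    ENNReal.toReal_add (by finiteness) (by finiteness),
    ENNReal.toReal_add (by finiteness) (by finiteness),
    ENNReal.toReal_ofReal', ENNReal.toReal_ofReal'] at h2
  simp only [ENNReal.coe_toReal] at h2
  change ((a - (C - C') : ℝ) : EReal) = ((A - B + D : ℝ) : EReal)
  rw [EReal.coe_eq_coe_iff]
  linarith

theorem ofReal_parts_eq (p q C : ℝ) :
    ENNReal.ofReal p + ENNReal.ofReal (-q) + ENNReal.ofReal (-C) =
      ENNReal.ofReal (max p 0 + max (-q) 0 + max (-C) 0) := by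
  rw [ENNReal.ofReal_add (by positivity) (by positivity),
    ENNReal.ofReal_add (by positivity) (by positivity)]
  simp only [ENNReal.ofReal_max, ENNReal.ofReal_zero, zero_le, sup_of_le_left]

theorem ofReal_parts_eq_of_nonneg {t : ℝ} (ht : 0 ≤ t) (p q C : ℝ) :
    ENNReal.ofReal t + ENNReal.ofReal C + ENNReal.ofReal q + ENNReal.ofReal (-p) =
      ENNReal.ofReal (t + max C 0 + max q 0 + max (-p) 0) := by
  rw [ENNReal.ofReal_add (by positivity) (by positivity),
    ENNReal.ofReal_add (by positivity) (by positivity),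
    ENNReal.ofReal_add (by positivity) (by positivity)]
  simp only [ENNReal.ofReal_max, ENNReal.ofReal_zero, zero_le, sup_of_le_left]

/-- Used with `p = a z`, `q = x z`, `t = φ z` and `C = φ* (a - x)`: Fenchel-Young rearranged into
nonnegative terms, so that no integrability is needed. -/
theorem ofReal_parts_le {p q t C : ℝ} (ht : 0 ≤ t) (h : p - q - t ≤ C) :
    ENNReal.ofReal p + ENNReal.ofReal (-q) + ENNReal.ofReal (-C) ≤
      ENNReal.ofReal t + ENNReal.ofReal C + ENNReal.ofReal q + ENNReal.ofReal (-p) := by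
  rw [ofReal_parts_eq, ofReal_parts_eq_of_nonneg ht]
  refine ENNReal.ofReal_le_ofReal ?_
  have h1 := max_zero_sub_max_neg_zero_eq_self p
  have h2 := max_zero_sub_max_neg_zero_eq_self q
  have h3 := max_zero_sub_max_neg_zero_eq_self C
  linarith

theorem ofReal_parts_congr {p q t C : ℝ} (ht : 0 ≤ t) (h : C = p - q - t) :
    ENNReal.ofReal p + ENNReal.ofReal (-q) + ENNReal.ofReal (-C) =
      ENNReal.ofReal t + ENNReal.ofReal C + ENNReal.ofReal q + ENNReal.ofReal (-p) := by
  rw [ofReal_parts_eq, ofReal_parts_eq_of_nonneg ht]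
  congr 1
  have h1 := max_zero_sub_max_neg_zero_eq_self p
  have h2 := max_zero_sub_max_neg_zero_eq_self q
  have h3 := max_zero_sub_max_neg_zero_eq_self C
  linarith

/-! ### Weak duality and the equality case -/

/-- Weak duality, with equality when the Fenchel-Young inequality is an equality. -/
theorem dual_le_primal {S : Type*} {G : MeasurableSpace S} [F : MeasurableSpace S]
    (hG : G ≤ F) (μ : Measure S) [IsProbabilityMeasure μ] {φ : ℝ → ℝ} (hφ : IsPhi φ)
    {x a c z : S → ℝ} (hx : Measurable x) (ha : Measurable[G] a) (hc : Measurable[G] c)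
    (hxc : ∀ᵐ s ∂μ, |x s| ≤ c s) (hz : Measurable z) (hz0 : ∀ s, 0 ≤ z s)
    (hz1 : condLExp G μ (fun s => ENNReal.ofReal (z s)) =ᵐ[μ] 1) :
    (∀ᵐ s ∂μ, (a s : EReal) - condExpGen G μ (fun r => conj φ (a r - x r)) s ≤
      condExpGen G (μ.withDensity fun s => ENNReal.ofReal (z s)) x s +
        (condDiv G μ φ (μ.withDensity fun s => ENNReal.ofReal (z s)) s : EReal)) ∧
    ((∀ᵐ s ∂μ, conj φ (a s - x s) = (a s - x s) * z s - φ (z s)) →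
      ∀ᵐ s ∂μ, (a s : EReal) - condExpGen G μ (fun r => conj φ (a r - x r)) s =
        condExpGen G (μ.withDensity fun s => ENNReal.ofReal (z s)) x s +
          (condDiv G μ φ (μ.withDensity fun s => ENNReal.ofReal (z s)) s : EReal)) := by
  have haF : Measurable a := ha.mono hG le_rfl
  have hZm : Measurable fun s => ENNReal.ofReal (z s) := hz.ennreal_ofReal
  have hCm : Measurable fun s => conj φ (a s - x s) :=
    (conj_mono hφ).measurable.comp (haF.sub hx)
  have hdiv : condDiv G μ φ (μ.withDensity fun s => ENNReal.ofReal (z s)) =ᵐ[μ]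
      condLExp G μ fun s => ENNReal.ofReal (φ (z s)) := by
    refine condLExp_congr_ae ?_
    filter_upwards [Measure.rnDeriv_withDensity μ hZm] with s hs
    rw [hs, ENNReal.toReal_ofReal (hz0 s)]
  have hpull : ∀ b : S → ℝ, Measurable[G] b →
      condLExp G μ (fun s => ENNReal.ofReal (b s * z s)) =ᵐ[μ]
        fun s => ENNReal.ofReal (b s) := fun b hb => by
    simp only [fun s => ENNReal.ofReal_mul' (p := b s) (hz0 s)]
    filter_upwards [condLExp_mul_of_measurable_left hG μ hb.ennreal_ofReal hZm, hz1] with s h1 h2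
    rw [h1, h2, Pi.one_apply, mul_one]
  have hbayes : ∀ y : S → ℝ, Measurable y →
      condExpNonneg G (μ.withDensity fun s => ENNReal.ofReal (z s)) y =ᵐ[μ]
        condLExp G μ fun s => ENNReal.ofReal (y s * z s) := fun y hy => by
    simp only [fun s => ENNReal.ofReal_mul' (p := y s) (hz0 s)]
    exact condLExp_withDensity_ae_eq hG μ hy.ennreal_ofReal hZm hz1
  -- The dominating `c z` has conditional expectation `ENNReal.ofReal (c s)`, since `c` pulls out.
  have hfin : ∀ y : S → ℝ, (∀ᵐ s ∂μ, y s ≤ c s) →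
      ∀ᵐ s ∂μ, condLExp G μ (fun s => ENNReal.ofReal (y s * z s)) s ≠ ∞ := fun y hy => by
    have hle : (fun s => ENNReal.ofReal (y s * z s)) ≤ᵐ[μ]
        fun s => ENNReal.ofReal (c s * z s) := by
      filter_upwards [hy] with s hs
      exact ENNReal.ofReal_le_ofReal (mul_le_mul_of_nonneg_right hs (hz0 s))
    filter_upwards [condLExp_mono (mΩ := G) hle, hpull c hc] with s h1 h2
    exact ne_top_of_le_ne_top (by rw [h2]; finiteness) h1
  have hfin1 := hfin x (hxc.mono fun s hs => (abs_le.1 hs).2)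
  have hfin2 := hfin (fun s => -x s) (hxc.mono fun s hs => (neg_le_abs _).trans hs)
  -- Since `φ*` is monotone, `φ* (a - x)` lies below the real valued `G`-measurable `φ* (a + c)`.
  have hfin3 : ∀ᵐ s ∂μ, condExpNonneg G μ (fun r => conj φ (a r - x r)) s ≠ ∞ := by
    have hle : (fun s => ENNReal.ofReal (conj φ (a s - x s))) ≤ᵐ[μ]
        fun s => ENNReal.ofReal (conj φ (a s + c s)) := by
      filter_upwards [hxc] with s hs
      exact ENNReal.ofReal_le_ofReal (conj_mono hφ (by linarith [(abs_le.1 hs).1]))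
    have hm : Measurable[G] fun s => ENNReal.ofReal (conj φ (a s + c s)) :=
      ((conj_mono hφ).measurable.comp (ha.add hc)).ennreal_ofReal
    filter_upwards [condLExp_mono (mΩ := G) hle] with s h
    rw [condLExp_eq_self hG μ hm] at h
    exact ne_top_of_le_ne_top ENNReal.ofReal_ne_top h
  have hfin4 : ∀ᵐ s ∂μ, condExpNonneg G μ (fun r => -conj φ (a r - x r)) s ≠ ∞ := by
    have hle : (fun s => ENNReal.ofReal (-conj φ (a s - x s))) ≤ᵐ[μ]
        fun _ => ENNReal.ofReal (φ 0) := Eventually.of_forall fun s =>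
      ENNReal.ofReal_le_ofReal (by linarith [neg_apply_zero_le_conj hφ (a s - x s)])
    filter_upwards [condLExp_mono (mΩ := G) hle] with s h
    rw [condLExp_const hG μ] at h
    exact ne_top_of_le_ne_top ENNReal.ofReal_ne_top h
  let l₁ : S → ℝ≥0∞ := fun s => ENNReal.ofReal (a s * z s)
  let l₂ : S → ℝ≥0∞ := fun s => ENNReal.ofReal (-x s * z s)
  let l₃ : S → ℝ≥0∞ := fun s => ENNReal.ofReal (-conj φ (a s - x s))
  let r₁ : S → ℝ≥0∞ := fun s => ENNReal.ofReal (φ (z s))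
  let r₂ : S → ℝ≥0∞ := fun s => ENNReal.ofReal (conj φ (a s - x s))
  let r₃ : S → ℝ≥0∞ := fun s => ENNReal.ofReal (x s * z s)
  let r₄ : S → ℝ≥0∞ := fun s => ENNReal.ofReal (-a s * z s)
  have hl : condLExp G μ (l₁ + l₂ + l₃) =ᵐ[μ]
      condLExp G μ l₁ + condLExp G μ l₂ + condLExp G μ l₃ :=
    (condLExp_add_right _ hCm.neg.ennreal_ofReal.aemeasurable).trans
      ((condLExp_add_right _ (hx.neg.mul hz).ennreal_ofReal.aemeasurable).add .rfl)
  have hr : condLExp G μ (r₁ + r₂ + r₃ + r₄) =ᵐ[μ]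
      condLExp G μ r₁ + condLExp G μ r₂ + condLExp G μ r₃ + condLExp G μ r₄ :=
    (condLExp_add_right _ (haF.neg.mul hz).ennreal_ofReal.aemeasurable).trans
      (((condLExp_add_right _ (hx.mul hz).ennreal_ofReal.aemeasurable).trans
        ((condLExp_add_right _ hCm.ennreal_ofReal.aemeasurable).add .rfl)).add .rfl)
  constructor
  · have hle : l₁ + l₂ + l₃ ≤ᵐ[μ] r₁ + r₂ + r₃ + r₄ := Eventually.of_forall fun s => by
      have := ofReal_parts_le (p := a s * z s) (q := x s * z s) (C := conj φ (a s - x s))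
        (hφ.nonneg _ (hz0 s))
        (by linarith [mul_sub_le_conj hφ (a s - x s) (hz0 s)])
      simpa only [l₁, l₂, l₃, r₁, r₂, r₃, r₄, Pi.add_apply, neg_mul] using this
    filter_upwards [condLExp_mono (mΩ := G) hle, hl, hr, hdiv, hpull a ha,
      hpull (fun s => -a s) ha.neg, hbayes x hx, hbayes (fun s => -x s) hx.neg, hfin1, hfin2,
      hfin3, hfin4] with s h hl hr hdiv hp1 hp2 hb1 hb2 hf1 hf2 hf3 hf4
    rw [hl, hr] at h
    simp only [Pi.add_apply, l₁, r₄, hp1, hp2] at h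
    simp only [condExpGen, hb1, hb2, hdiv]
    exact coe_sub_sub_le hf1 hf2 hf3 hf4 h
  · intro heq
    have heq' : l₁ + l₂ + l₃ =ᵐ[μ] r₁ + r₂ + r₃ + r₄ := by
      filter_upwards [heq] with s hs
      have := ofReal_parts_congr (p := a s * z s) (q := x s * z s) (C := conj φ (a s - x s))
        (hφ.nonneg _ (hz0 s))
        (by rw [hs]; ring)
      simpa only [l₁, l₂, l₃, r₁, r₂, r₃, r₄, Pi.add_apply, neg_mul] using this
    filter_upwards [condLExp_congr_ae (mΩ := G) heq', hl, hr, hdiv, hpull a ha,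
      hpull (fun s => -a s) ha.neg, hbayes x hx, hbayes (fun s => -x s) hx.neg, hfin1, hfin2,
      hfin3, hfin4] with s h hl hr hdiv hp1 hp2 hb1 hb2 hf1 hf2 hf3 hf4
    rw [hl, hr] at h
    simp only [Pi.add_apply, l₁, r₄, hp1, hp2] at h
    simp only [condExpGen, hb1, hb2, hdiv]
    exact coe_sub_sub_eq hf1 hf2 hf3 hf4 h

/-! ### Measures in `measuresM` and their densities -/

theorem condExpGen_of_nonneg {S : Type*} {G : MeasurableSpace S} [F : MeasurableSpace S]
    (hG : G ≤ F) (μ : Measure S) [IsFiniteMeasure μ] {z : S → ℝ} (hz0 : ∀ᵐ s ∂μ, 0 ≤ z s) :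
    ∀ᵐ s ∂μ, condExpGen G μ z s = (condLExp G μ (fun s => ENNReal.ofReal (z s)) s : EReal) := by
  have h0 : (fun s => ENNReal.ofReal (-z s)) =ᵐ[μ] fun _ => 0 := by
    filter_upwards [hz0] with s hs
    exact ENNReal.ofReal_of_nonpos (by linarith)
  filter_upwards [condLExp_congr_ae (mΩ := G) h0] with s hs
  rw [condLExp_const hG μ] at hs
  simp [condExpGen, condExpNonneg, hs]

theorem lintegral_condExpNonneg_indicator {S : Type*} {G : MeasurableSpace S}
    [F : MeasurableSpace S] (hG : G ≤ F) (μ : Measure S) [IsFiniteMeasure μ] (z : S → ℝ)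
    {A : Set S} (hA : MeasurableSet A) :
    ∫⁻ s, condExpNonneg G μ (A.indicator z) s ∂μ =
      μ.withDensity (fun s => ENNReal.ofReal (z s)) A := by
  rw [condExpNonneg, lintegral_condLExp hG, withDensity_apply _ hA, ← lintegral_indicator hA]
  refine lintegral_congr fun s => ?_
  by_cases hs : s ∈ A <;> simp [hs]

/-- The elements of `measuresM` have a nonnegative density with conditional expectation one. -/
theorem exists_density_of_mem_measuresM {S : Type*} {G : MeasurableSpace S}
    [F : MeasurableSpace S] (hG : G ≤ F) {μ : Measure S} [IsProbabilityMeasure μ] {ν : Measure S}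
    (hν : ν ∈ measuresM G μ) :
    ∃ z : S → ℝ, Measurable z ∧ (∀ s, 0 ≤ z s) ∧
      condLExp G μ (fun s => ENNReal.ofReal (z s)) =ᵐ[μ] 1 ∧
      ν = μ.withDensity fun s => ENNReal.ofReal (z s) := by
  obtain ⟨-, z, ⟨⟨hz, -⟩, hz0, hz1⟩, hνz⟩ := hν
  -- The given density is nonnegative only almost surely; its positive part is so everywhere, and
  -- `ENNReal.ofReal` sees no difference.
  have hmax : (fun s => ENNReal.ofReal (max (z s) 0)) = fun s => ENNReal.ofReal (z s) := by
    simp only [ENNReal.ofReal_max, ENNReal.ofReal_zero, zero_le, sup_of_le_left]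
  refine ⟨fun s => max (z s) 0, hz.max measurable_const, fun s => le_max_right _ _, ?_, ?_⟩
  · rw [hmax]
    filter_upwards [hz1, condExpGen_of_nonneg hG μ hz0] with s h1 h2
    rw [h1] at h2
    exact_mod_cast h2.symm
  · rw [hmax]
    ext A hA
    rw [hνz A hA, lintegral_condExpNonneg_indicator hG μ z hA]

theorem withDensity_mem_measuresM {S : Type*} {G : MeasurableSpace S} [F : MeasurableSpace S]
    (hG : G ≤ F) {μ : Measure S} [IsProbabilityMeasure μ] {z : S → ℝ} (hz : Measurable z)
    (hz0 : ∀ s, 0 ≤ z s) (hz1 : condLExp G μ (fun s => ENNReal.ofReal (z s)) =ᵐ[μ] 1) :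
    (μ.withDensity fun s => ENNReal.ofReal (z s)) ∈ measuresM G μ := by
  refine ⟨⟨?_⟩, z, ⟨⟨hz, ?_⟩, Eventually.of_forall hz0, ?_⟩, fun A hA =>
    (lintegral_condExpNonneg_indicator hG μ z hA).symm⟩
  · rw [withDensity_apply _ MeasurableSet.univ, Measure.restrict_univ, ← lintegral_condLExp hG μ,
      lintegral_congr_ae hz1]
    simp
  · simp only [condExpNonneg, abs_of_nonneg (hz0 _)]
    filter_upwards [hz1] with s hs
    simp [hs]
  · filter_upwards [hz1, condExpGen_of_nonneg hG μ (Eventually.of_forall hz0)] with s h1 h2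
    simp [h2, h1]

theorem measurable_condExpGen {S : Type*} (G : MeasurableSpace S) [F : MeasurableSpace S]
    (μ : Measure S) (x : S → ℝ) : Measurable[G] (condExpGen G μ x) :=
  (measurable_coe_ennreal_ereal.comp (measurable_condLExp G μ _)).sub
    (measurable_coe_ennreal_ereal.comp (measurable_condLExp G μ _))

end CondOCE

/-! ### Strong duality -/

theorem theorem1 {S : Type*} (G : MeasurableSpace S) [F : MeasurableSpace S] (hG : G ≤ F)
    (μ : Measure S) [IsProbabilityMeasure μ]
    (φ : ℝ → ℝ) (hφ : CondOCE.IsPhi φ)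
    (x : S → ℝ) (hx : CondOCE.MemLinfty G μ x) :
    ∃ v : S → EReal,
      CondOCE.IsEssInf G μ
        {f : S → EReal | ∃ ν ∈ CondOCE.measuresM G μ,
          f = fun s => CondOCE.condExpGen G ν x s + (CondOCE.condDiv G μ φ ν s : EReal)} v ∧
      CondOCE.IsEssSup G μ
        {f : S → EReal | ∃ a : S → ℝ, Measurable[G] a ∧
          f = fun s => (a s : EReal) -
            CondOCE.condExpGen G μ (fun r => CondOCE.conj φ (a r - x r)) s} v := by
  obtain ⟨hxm, c, hc, hxc⟩ := (CondOCE.memLinfty_iff G hG μ x).1 hx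
  obtain ⟨g, hgc, hg, hg0, hg1, hconj⟩ := CondOCE.exists_continuous_argmax hφ
  -- Conditioning on the identity map from `(S, F)` to `(S, G)` is conditioning on `G`. The bound
  -- must be nonnegative everywhere, hence `|c|` in place of `c`.
  obtain ⟨α, hα, -, hz1⟩ := @CondOCE.exists_condLExp_shift_eq_one S S F G μ _ id
    (measurable_id'' hG) x hxm g hgc hg hg1 (fun s => |c s|) (continuous_abs.measurable.comp hc)
    (fun s => abs_nonneg _) (hxc.mono fun s hs => hs.trans (le_abs_self _))
  rw [MeasurableSpace.comap_id] at hz1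
  simp only [id_eq] at hz1
  have hz : Measurable fun s => g (α s - x s) :=
    hgc.measurable.comp ((hα.mono hG le_rfl).sub hxm)
  have hz0 : ∀ s, 0 ≤ g (α s - x s) := fun s => hg0 _
  have hmem := CondOCE.withDensity_mem_measuresM hG hz hz0 hz1
  have heq := (CondOCE.dual_le_primal hG μ hφ hxm hα hc hxc hz hz0 hz1).2
    (Eventually.of_forall fun s => hconj _)
  have hweak : ∀ ν ∈ CondOCE.measuresM G μ, ∀ a : S → ℝ, Measurable[G] a →
      (fun s => (a s : EReal) - CondOCE.condExpGen G μ (fun r => CondOCE.conj φ (a r - x r)) s)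
        ≤ᵐ[μ] fun s => CondOCE.condExpGen G ν x s + (CondOCE.condDiv G μ φ ν s : EReal) := by
    intro ν hν a ha
    obtain ⟨z, hz, hz0, hz1, rfl⟩ := CondOCE.exists_density_of_mem_measuresM hG hν
    exact (CondOCE.dual_le_primal hG μ hφ hxm ha hc hxc hz hz0 hz1).1
  have hv : Measurable[G] fun s => (α s : EReal) -
      CondOCE.condExpGen G μ (fun r => CondOCE.conj φ (α r - x r)) s :=
    (measurable_coe_real_ereal.comp hα).sub (CondOCE.measurable_condExpGen G μ _)
  -- The common value is the dual value at `α`; by `heq` it is also the primal value at the density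
  -- `g (α - x)`, so both extrema are attained.
  refine ⟨_, ⟨hv, ?_, fun w _ hw => ?_⟩, ⟨hv, ?_, fun w _ hw => hw _ ⟨α, hα, rfl⟩⟩⟩
  · rintro _ ⟨ν, hν, rfl⟩
    exact hweak ν hν α hα
  · exact (hw _ ⟨_, hmem, rfl⟩).trans (EventuallyEq.symm heq).le
  · rintro _ ⟨a, ha, rfl⟩
    exact (hweak _ hmem a ha).trans (EventuallyEq.symm heq).le
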